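/- Let $d\in\mathbb N$, let $\mathcal A$ be a finite set, let $(\Omega,\mathcal F,\Pr)$ be a probability space and let $\theta:\Omega\to\Omega$ be an invertible bi-measurable measure-preserving map. A \emph{state} is a positive semidefinite matrix $\varrho\in\mathbb M_d(\mathbb C)$ with $\operatorname{tr}\varrho=1$; it is \emph{pure} if it is a rank-one orthogonal projection and \emph{mixed} otherwise. Let $\mathcal V=\{V_{a;\omega}\}_{a\in\mathcal A}$ be a disordered perfect Kraus measurement ensemble: each $\omega\mapsto V_{a;\omega}\in\mathbb M_d(\mathbb C)$ is measurable and $\sum_{a\in\mathcal A}V_{a;\omega}^\dagger V_{a;\omega}=1$ for every $\omega$. For a matrix $W$ and a state $\varrho$ with $\operatorname{tr}(W\varrho W^\dagger)\neq0$ put $W\cdot\varrho=W\varrho W^\dagger/\operatorname{tr}(W\varrho W^\dagger)$ (and, say, $W\cdot\varrho=\varrho$ otherwise). For $\bar a=(a_1,a_2,\dots)\in\mathcal A^{\mathbb N}$ let $V^{(n)}_{\bar a;\omega}=V_{a_n;\theta^n(\omega)}\cdots V_{a_1;\theta(\omega)}$ and $\rho^{(n)}_{\varrho;\omega}(\bar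 a)=V^{(n)}_{\bar a;\omega}\cdot\varrho$, and let $\mathbb Q_{\varrho;\omega}$ be the probability measure on $\mathcal A^{\mathbb N}$ under which, given $a_1,\dots,a_n$, the next outcome is $a$ with probability $\operatorname{tr}\big(V_{a;\theta^{n+1}(\omega)}\,\rho^{(n)}_{\varrho;\omega}\,V_{a;\theta^{n+1}(\omega)}^\dagger\big)$; thus the first $n$ outcomes are $(a_1,\dots,a_n)$ with probability $\operatorname{tr}\big(V^{(n)}_{\bar a;\omega}\varrho V^{(n)\dagger}_{\bar a;\omega}\big)$. The \emph{purification event} $X$ is the set of those $\omega\in\Omega$ such that, for every state $\varrho$ and every $m\ge1$, $\operatorname{tr}\big((\rho^{(n)}_{\varrho;\omega})^m\big)\to1$ as $n\to\infty$, $\mathbb Q_{\varrho;\omega}$-almost surely. Finally, let $$\delta^{(m)}_\omega(\varrho)=\sum_{a\in\mathcal A}\operatorname{tr}\big(V_{a;\omega}\varrho V_{a;\omega}^\dagger\big)\Big(\operatorname{tr}\big((V_{a;\omega}\cdot\varrho)^m\big)-\operatorname{tr}(\varrho^m)\Big)^2 .$$ Then for almost every $\omega\in\Omega\setminus X$ there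 is a mixed state $\psi$ such that \begin{enumerate} \item[(i)] $\delta^{(m)}_\omega(\psi)=0$ for all $m\in\{1,\dots,d\}$; \item[(ii)] for every $a\in\mathcal A$ there is $\lambda_a\ge0$ such that $V_{a;\omega}\psi V_{a;\omega}^\dagger$ is unitarily equivalent to $\lambda_a\psi$; \item[(iii)] the orthogonal projection $p$ onto the range of $\psi$ has rank at least $2$, and for every $a\in\mathcal A$ there is $\mu_a\in[0,1]$ such that $pV_{a;\omega}^\dagger V_{a;\omega}p=\mu_a p$. \end{enumerate} In particular, for almost every $\omega\in\Omega\setminus X$ there is an orthogonal projection $p$ of rank at least $2$ with $pV_{a;\omega}^\dagger V_{a;\omega}p\propto p$ for all $a\in\mathcal A$. -/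

import Mathlib

open MeasureTheory ProbabilityTheory Filter Topology
open scoped Matrix ComplexOrder ENNReal

noncomputable section

namespace DisorderedTrajectory

/-- A quantum state on `ℂ^d`: a positive semidefinite matrix of trace one. -/
structure State (d : ℕ) where
  mat : Matrix (Fin d) (Fin d) ℂ
  posSemidef : mat.PosSemidef
  trace_eq_one : mat.trace = 1

/-- A pure state is a rank-one orthogonal projection. -/
def State.IsPure {d : ℕ} (ρ : State d) : Prop :=
  IsStarProjection ρ.mat ∧ ρ.mat.rank = 1

/-- A mixed state is a state that is not pure. -/
def State.IsMixed {d : ℕ} (ρ : State d) : Prop := ¬ ρ.IsPure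

/-- A perfect Kraus measurement on `ℂ^d` with outcome set `A`: one Kraus matrix `op a` for each
outcome `a`, with `∑ₐ (op a)ᴴ (op a) = 1`. -/
structure KrausMeasurement (d : ℕ) (A : Type*) [Fintype A] where
  op : A → Matrix (Fin d) (Fin d) ℂ
  sum_eq_one : ∑ a, (op a)ᴴ * op a = 1

/-- `tr (W ρ Wᴴ)`, a nonnegative real number (see `trace_conj_eq`). -/
def weight {d : ℕ} (W : Matrix (Fin d) (Fin d) ℂ) (ρ : State d) : ℝ :=
  (W * ρ.mat * Wᴴ).trace.re

theorem trace_conj_nonneg {d : ℕ} (W : Matrix (Fin d) (Fin d) ℂ) (ρ : State d) :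
    0 ≤ (W * ρ.mat * Wᴴ).trace :=
  (ρ.posSemidef.mul_mul_conjTranspose_same W).trace_nonneg

theorem trace_conj_eq {d : ℕ} (W : Matrix (Fin d) (Fin d) ℂ) (ρ : State d) :
    (W * ρ.mat * Wᴴ).trace = (weight W ρ : ℂ) :=
  Complex.ext rfl (Complex.nonneg_iff.1 (trace_conj_nonneg W ρ)).2.symm

theorem weight_nonneg {d : ℕ} (W : Matrix (Fin d) (Fin d) ℂ) (ρ : State d) :
    0 ≤ weight W ρ :=
  (Complex.nonneg_iff.1 (trace_conj_nonneg W ρ)).1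

theorem sum_weight {d : ℕ} {A : Type*} [Fintype A] (V : KrausMeasurement d A) (ρ : State d) :
    ∑ a, weight (V.op a) ρ = 1 := by
  have h : ∑ a, (V.op a * ρ.mat * (V.op a)ᴴ).trace = 1 := by
    calc ∑ a, (V.op a * ρ.mat * (V.op a)ᴴ).trace
        = ∑ a, ((V.op a)ᴴ * V.op a * ρ.mat).trace := by
          refine Finset.sum_congr rfl fun a _ => ?_
          rw [Matrix.trace_mul_comm, Matrix.mul_assoc]
      _ = ((∑ a, (V.op a)ᴴ * V.op a) * ρ.mat).trace := by
          rw [Finset.sum_mul, Matrix.trace_sum]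
      _ = 1 := by rw [V.sum_eq_one, one_mul, ρ.trace_eq_one]
  simp only [trace_conj_eq] at h
  exact_mod_cast h

open Classical in
/-- The state `W · ρ = W ρ Wᴴ / tr (W ρ Wᴴ)`. When `tr (W ρ Wᴴ) = 0`, i.e. for an outcome of
probability zero, it is set to be `ρ` itself. -/
def act {d : ℕ} (W : Matrix (Fin d) (Fin d) ℂ) (ρ : State d) : State d :=
  if h : weight W ρ = 0 then ρ
  else
    { mat := ((weight W ρ)⁻¹ : ℝ) • (W * ρ.mat * Wᴴ)
      posSemidef := (ρ.posSemidef.mul_mul_conjTranspose_same W).smul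
        (inv_nonneg.2 (weight_nonneg W ρ))
      trace_eq_one := by
        rw [Matrix.trace_smul, trace_conj_eq, Complex.real_smul, ← Complex.ofReal_mul,
          inv_mul_cancel₀ h, Complex.ofReal_one] }

/-- The law of the outcome when `V` is measured in the state `ρ`: outcome `a` has probability
`tr (Vₐ ρ Vₐᴴ)`. -/
def outcomeLaw {d : ℕ} {A : Type*} [Fintype A] (V : KrausMeasurement d A) (ρ : State d) : PMF A :=
  PMF.ofFintype (fun a => ENNReal.ofReal (weight (V.op a) ρ)) (by
    rw [← ENNReal.ofReal_sum_of_nonneg fun a _ => weight_nonneg (V.op a) ρ, sum_weight,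
      ENNReal.ofReal_one])

section Trajectory

variable {d : ℕ} {A : Type*} [Fintype A]

/-- For a sequence of measurements `W 0, W 1, …` and outcomes `a 0, a 1, …`, the product
`(W (n-1))_{a (n-1)} ⋯ (W 0)_{a 0}` of the first `n` Kraus matrices. -/
def prodOp (W : ℕ → KrausMeasurement d A) (a : ℕ → A) : ℕ → Matrix (Fin d) (Fin d) ℂ
  | 0 => 1
  | n + 1 => (W n).op (a n) * prodOp W a n

/-- The state after the first `n` measurements, given the outcomes. -/
def trajState (W : ℕ → KrausMeasurement d A) (ρ : State d) (a : ℕ → A) (n : ℕ) : State d :=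
  act (prodOp W a n) ρ

/-- Extend a finite record of outcomes `a 0, …, a n` to an infinite one; only the first `n + 1`
entries matter below. -/
def extendRecord {n : ℕ} (a : Finset.Iic n → A) : ℕ → A :=
  fun i => a ⟨min i n, Finset.mem_Iic.2 (min_le_right i n)⟩

variable [MeasurableSpace A] [MeasurableSingletonClass A]

/-- The law of outcome number `n + 1`, given the outcomes number `0, …, n`. -/
def nextOutcome (W : ℕ → KrausMeasurement d A) (ρ : State d) (n : ℕ) :
    Kernel (Finset.Iic n → A) A :=
  Kernel.ofFunOfCountable fun a =>
    (outcomeLaw (W (n + 1)) (trajState W ρ (extendRecord a) (n + 1))).toMeasure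

instance (W : ℕ → KrausMeasurement d A) (ρ : State d) (n : ℕ) :
    IsMarkovKernel (nextOutcome W ρ n) :=
  ⟨fun a => PMF.toMeasure.isProbabilityMeasure
    (outcomeLaw (W (n + 1)) (trajState W ρ (extendRecord a) (n + 1)))⟩

/-- The quantum probability: the law, on the space `ℕ → A` of infinite records, of the outcomes of
the successive measurements `W 0, W 1, …` started in the state `ρ`. -/
def quantumLaw (W : ℕ → KrausMeasurement d A) (ρ : State d) : Measure (ℕ → A) :=
  Kernel.trajMeasure (X := fun _ => A) (outcomeLaw (W 0) ρ).toMeasure (nextOutcome W ρ)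

end Trajectory

section Disorder

variable {Ω : Type*} {d : ℕ} {A : Type*} [Fintype A]

/-- The measurements performed along the orbit of `ω`: the `n`-th measurement (counting from `1`)
is `V` at `θ^n ω`. -/
def orbitMeasurement (θ : Ω → Ω) (V : Ω → KrausMeasurement d A) (ω : Ω) :
    ℕ → KrausMeasurement d A :=
  fun n => V (θ^[n + 1] ω)

/-- The purification event: the `ω` such that, for every initial state `ρ` and every `m ≥ 1`,
`tr ((ρ^{(n)})^m) → 1` as `n → ∞`, almost surely for the quantum probability. -/
def purificationEvent [MeasurableSpace A] [MeasurableSingletonClass A]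
    (θ : Ω → Ω) (V : Ω → KrausMeasurement d A) : Set Ω :=
  {ω | ∀ ρ : State d, ∀ m : ℕ, 1 ≤ m →
    ∀ᵐ a ∂(quantumLaw (orbitMeasurement θ V ω) ρ),
      Tendsto (fun n => ((trajState (orbitMeasurement θ V ω) ρ a n).mat ^ m).trace.re)
        atTop (𝓝 1)}

end Disorder

/-- `δ^{(m)}(ρ) = ∑ₐ tr (Vₐ ρ Vₐᴴ) (tr ((Vₐ · ρ)^m) - tr (ρ^m))²`. -/
def delta {d : ℕ} {A : Type*} [Fintype A] (V : KrausMeasurement d A) (m : ℕ) (ρ : State d) : ℝ :=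
  ∑ a, weight (V.op a) ρ *
    (((act (V.op a) ρ).mat ^ m).trace.re - (ρ.mat ^ m).trace.re) ^ 2

/-- Unitary equivalence of matrices. -/
def UnitarilyEquivalent {d : ℕ} (M N : Matrix (Fin d) (Fin d) ℂ) : Prop :=
  ∃ U ∈ Matrix.unitaryGroup (Fin d) ℂ, M = U * N * Uᴴ

end DisorderedTrajectory

end

noncomputable section

namespace DisorderedTrajectory

/-! The argument follows the purity tr ρ² along a trajectory. Write ρ = B² with B Hermitian and c_a
= tr(V_a ρ V_a†). Expanding the Hilbert–Schmidt norm and using ∑ V_a†V_a = 1, the expected increase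
of purity in one measurement is the sum of c_a⁻¹ ‖B V_a†V_a B − c_a ρ‖² over the outcomes with c_a >
0. So purity is a bounded submartingale, and a state that gains nothing satisfies B V_a†V_a B = c_a
ρ for every a.

If purification fails at ω, the expected purity increases to some L < 1 and the gains tend to 0. At
every late time, some state with purity bounded away from 1 then gains almost nothing
(`exists_nearly_dark_of_not_purify`). By Poincaré recurrence, for almost every ω the measurements
along the orbit come back arbitrarily close to V_ω. Compactness of the states of purity at most 1 −
c and continuity of the defect then give a state ψ with zero defect for V_ω itself
(`exists_sum_termDefect_eq_zero`).

The rest is algebra (`exists_dark_of_sum_termDefect_eq_zero`): V_a ψ V_a† = (V_a B)(V_a B)† has the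
spectrum of (V_a B)†(V_a B) = c_a ψ, which gives (ii) and (i). Compressing the same identity by the
pseudo-inverse of B gives (iii) with μ_a = c_a. -/

/-! ### Spectral calculus: square root and pseudo-inverse -/

theorem exists_diagonalization {d : ℕ} {M : Matrix (Fin d) (Fin d) ℂ} (hM : M.IsHermitian) :
    ∃ U ∈ Matrix.unitaryGroup (Fin d) ℂ, Uᴴ * U = 1 ∧
      M = U * Matrix.diagonal (fun i => (hM.eigenvalues i : ℂ)) * Uᴴ := by
  refine ⟨hM.eigenvectorUnitary, SetLike.coe_mem _, Unitary.coe_star_mul_self _, ?_⟩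
  have h := hM.spectral_theorem
  rw [Unitary.conjStarAlgAut_apply] at h
  exact h

/-- A positive semidefinite matrix has a Hermitian square root `B`, and `B` has a Hermitian
pseudo-inverse `T`, such that `B * T` is the orthogonal projection onto the range. -/
theorem exists_sqrt_pseudoInverse {d : ℕ} {M : Matrix (Fin d) (Fin d) ℂ} (hM : M.PosSemidef) :
    ∃ B T : Matrix (Fin d) (Fin d) ℂ, Bᴴ = B ∧ Tᴴ = T ∧ B * B = M ∧ T * B = B * T ∧
      B * T * B = B ∧ T * B * T = T := by
  obtain ⟨U, -, hU, hMU⟩ := exists_diagonalization hM.isHermitian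
  have hl := hM.eigenvalues_nonneg
  generalize hM.isHermitian.eigenvalues = l at hMU hl
  have hmul : ∀ f g : Fin d → ℝ,
      (U * Matrix.diagonal (fun i => (f i : ℂ)) * Uᴴ) *
        (U * Matrix.diagonal (fun i => (g i : ℂ)) * Uᴴ) =
      U * Matrix.diagonal (fun i => ((f i * g i : ℝ) : ℂ)) * Uᴴ := by
    intro f g
    calc _ = U * Matrix.diagonal (fun i => (f i : ℂ)) * (Uᴴ * U) *
          Matrix.diagonal (fun i => (g i : ℂ)) * Uᴴ := by simp only [Matrix.mul_assoc]
      _ = _ := by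
        rw [hU, Matrix.mul_one, Matrix.mul_assoc U, Matrix.diagonal_mul_diagonal]
        simp only [Complex.ofReal_mul]
  have hherm : ∀ f : Fin d → ℝ, (U * Matrix.diagonal (fun i => (f i : ℂ)) * Uᴴ)ᴴ =
      U * Matrix.diagonal (fun i => (f i : ℂ)) * Uᴴ := by
    intro f
    simp only [Matrix.conjTranspose_mul, Matrix.conjTranspose_conjTranspose,
      Matrix.diagonal_conjTranspose, Matrix.mul_assoc]
    congr 3
    ext i
    simp
  -- The convention 0⁻¹ = 0 makes the second matrix vanish on the kernel, as a pseudo-inverse must.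
  refine ⟨U * Matrix.diagonal (fun i => (Real.sqrt (l i) : ℂ)) * Uᴴ,
    U * Matrix.diagonal (fun i => (((Real.sqrt (l i))⁻¹ : ℝ) : ℂ)) * Uᴴ,
    hherm _, hherm _, ?_, ?_, ?_, ?_⟩
  · simp only [hmul, hMU, Real.mul_self_sqrt (hl _)]
  · simp only [hmul, mul_comm]
  · simp only [hmul, mul_inv_mul_cancel]
  · have h : ∀ x : ℝ, x⁻¹ * x * x⁻¹ = x⁻¹ := fun x => by simpa using mul_inv_mul_cancel x⁻¹
    simp only [hmul, h]

/-! ### Purity gain and defect of a measurement -/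

/-- The purity `tr ρ²`. -/
def purity {d : ℕ} (ρ : State d) : ℝ := (ρ.mat ^ 2).trace.re

theorem trace_self_mul_nonneg {d : ℕ} {Y : Matrix (Fin d) (Fin d) ℂ} (hY : Yᴴ = Y) :
    0 ≤ (Y * Y).trace.re := by
  have := (Matrix.posSemidef_conjTranspose_mul_self Y).trace_nonneg
  rw [hY] at this
  exact (Complex.nonneg_iff.1 this).1

theorem eq_zero_of_trace_self_mul {d : ℕ} {Y : Matrix (Fin d) (Fin d) ℂ} (hY : Yᴴ = Y)
    (h : (Y * Y).trace.re = 0) : Y = 0 := by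
  have h0 := (Matrix.posSemidef_conjTranspose_mul_self Y).trace_nonneg
  rw [← Matrix.trace_conjTranspose_mul_self_eq_zero_iff]
  refine Complex.ext ?_ (Complex.nonneg_iff.1 h0).2.symm
  rw [hY]; exact h

/-- For a square root `B` of `M`, this is the squared Hilbert–Schmidt norm of
`B Wᴴ W B - tr (W M Wᴴ) M`, see `termDefect_eq`. -/
def termDefect {d : ℕ} (W M : Matrix (Fin d) (Fin d) ℂ) : ℝ :=
  ((W * M * Wᴴ) ^ 2).trace.re
    - 2 * (W * M * Wᴴ).trace.re * (W * (M * M) * Wᴴ).trace.re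
    + (W * M * Wᴴ).trace.re ^ 2 * (M ^ 2).trace.re

/-- Expand the square; cyclicity of the trace removes B from every term. The defect is thus a
polynomial in the real and imaginary parts of the entries of W and M, hence continuous, while its
sign is visible from the square. -/
theorem termDefect_eq {d : ℕ} (W : Matrix (Fin d) (Fin d) ℂ) {M B : Matrix (Fin d) (Fin d) ℂ}
    (hB : B * B = M) {c : ℝ} (hc : (W * M * Wᴴ).trace.re = c) :
    termDefect W M =
      ((B * Wᴴ * W * B - c • M) * (B * Wᴴ * W * B - c • M)).trace.re := by
  have h1 : ((B * Wᴴ * W * B) * (B * Wᴴ * W * B)).trace = ((W * M * Wᴴ) ^ 2).trace := by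
    rw [pow_two, ← hB, show B * Wᴴ * W * B * (B * Wᴴ * W * B)
      = (B * Wᴴ) * (W * B * B * Wᴴ * W * B) by simp only [Matrix.mul_assoc],
      Matrix.trace_mul_comm]
    simp only [Matrix.mul_assoc]
  have h2 : ((B * Wᴴ * W * B) * M).trace = (W * (M * M) * Wᴴ).trace := by
    rw [← hB, show B * Wᴴ * W * B * (B * B) = (B * Wᴴ) * (W * B * B * B) by
      simp only [Matrix.mul_assoc], Matrix.trace_mul_comm]
    simp only [Matrix.mul_assoc]
  have h3 : (M * (B * Wᴴ * W * B)).trace = (W * (M * M) * Wᴴ).trace := by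
    rw [Matrix.trace_mul_comm, h2]
  rw [termDefect, hc]
  simp only [sub_mul, mul_sub, Matrix.trace_sub, Matrix.smul_mul, Matrix.mul_smul,
    Matrix.trace_smul, h1, h2, h3, Complex.sub_re, Complex.real_smul, Complex.re_ofReal_mul,
    pow_two M]
  ring

theorem termDefect_nonneg {d : ℕ} (W : Matrix (Fin d) (Fin d) ℂ) (ρ : State d) :
    0 ≤ termDefect W ρ.mat := by
  obtain ⟨B, T, hB, -, hBB, -⟩ := exists_sqrt_pseudoInverse ρ.posSemidef
  rw [termDefect_eq W hBB rfl]
  apply trace_self_mul_nonneg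
  simp [hB, ρ.posSemidef.isHermitian.eq, Matrix.mul_assoc]

theorem act_mat {d : ℕ} {W : Matrix (Fin d) (Fin d) ℂ} {ρ : State d} (h : weight W ρ ≠ 0) :
    (act W ρ).mat = ((weight W ρ)⁻¹ : ℝ) • (W * ρ.mat * Wᴴ) := by
  rw [act, dif_neg h]

/-- The expected increase of the purity under the measurement `V`. -/
def purityGain {d : ℕ} {A : Type*} [Fintype A] (V : KrausMeasurement d A) (ρ : State d) : ℝ :=
  ∑ a, weight (V.op a) ρ * purity (act (V.op a) ρ) - purity ρ

theorem weight_le_one {d : ℕ} {A : Type*} [Fintype A] (V : KrausMeasurement d A) (ρ : State d)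
    (a : A) : weight (V.op a) ρ ≤ 1 := by
  rw [← sum_weight V ρ]
  exact Finset.single_le_sum (fun b _ => weight_nonneg (V.op b) ρ) (Finset.mem_univ a)

/-- The weight is the squared Hilbert–Schmidt norm of W B, where B² = ρ. -/
theorem mul_eq_zero_of_weight_eq_zero {d : ℕ} {W : Matrix (Fin d) (Fin d) ℂ} {ρ : State d}
    (h : weight W ρ = 0) : W * ρ.mat = 0 := by
  obtain ⟨B, T, hB, -, hBB, -⟩ := exists_sqrt_pseudoInverse ρ.posSemidef
  have h0 : (W * B) * (W * B)ᴴ = 0 := by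
    rw [Matrix.conjTranspose_mul, hB, ← Matrix.mul_assoc, Matrix.mul_assoc W B B, hBB]
    rw [← (ρ.posSemidef.mul_mul_conjTranspose_same W).trace_eq_zero_iff, trace_conj_eq, h,
      Complex.ofReal_zero]
  rw [← hBB, ← Matrix.mul_assoc, Matrix.self_mul_conjTranspose_eq_zero.1 h0, Matrix.zero_mul]

/-- For nonzero weight the right side is the defect divided by the weight. Dropping that factor,
which is at least 1, avoids a denominator in the later compactness argument. -/
theorem termDefect_le {d : ℕ} {W : Matrix (Fin d) (Fin d) ℂ} {ρ : State d}
    (hle : weight W ρ ≤ 1) :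
    termDefect W ρ.mat ≤ weight W ρ * purity (act W ρ)
      - 2 * (W * (ρ.mat * ρ.mat) * Wᴴ).trace.re + weight W ρ * purity ρ := by
  have h0 := termDefect_nonneg W ρ
  rcases eq_or_ne (weight W ρ) 0 with h | h
  · have hW := mul_eq_zero_of_weight_eq_zero h
    simp [termDefect, h, hW, ← Matrix.mul_assoc]
  · have hp : 0 < weight W ρ := lt_of_le_of_ne (weight_nonneg W ρ) h.symm
    have h1 : weight W ρ * purity (act W ρ)
        - 2 * (W * (ρ.mat * ρ.mat) * Wᴴ).trace.re + weight W ρ * purity ρ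
        = (weight W ρ)⁻¹ * termDefect W ρ.mat := by
      rw [purity, act_mat h, smul_pow, Matrix.trace_smul, Complex.real_smul,
        Complex.re_ofReal_mul, termDefect, ← weight, ← purity]
      field_simp
    rw [h1]
    exact le_mul_of_one_le_left h0 ((one_le_inv₀ hp).2 hle)

/-- Completeness of the Kraus family turns the cross terms into −2 tr ρ², and the weights sum to 1,
so the right sides of `termDefect_le` add up to the gain. -/
theorem sum_termDefect_le_purityGain {d : ℕ} {A : Type*} [Fintype A] (V : KrausMeasurement d A)
    (ρ : State d) : ∑ a, termDefect (V.op a) ρ.mat ≤ purityGain V ρ := by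
  have hs : ∑ a, (V.op a * (ρ.mat * ρ.mat) * (V.op a)ᴴ).trace.re = purity ρ := by
    rw [← Complex.re_sum, purity, pow_two]
    congr 1
    calc ∑ a, (V.op a * (ρ.mat * ρ.mat) * (V.op a)ᴴ).trace
        = ∑ a, ((V.op a)ᴴ * V.op a * (ρ.mat * ρ.mat)).trace := by
          refine Finset.sum_congr rfl fun a _ => ?_
          rw [Matrix.trace_mul_comm, Matrix.mul_assoc]
      _ = _ := by rw [← Matrix.trace_sum, ← Finset.sum_mul, V.sum_eq_one, one_mul]
  calc _ ≤ ∑ a, (weight (V.op a) ρ * purity (act (V.op a) ρ)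
      - 2 * (V.op a * (ρ.mat * ρ.mat) * (V.op a)ᴴ).trace.re + weight (V.op a) ρ * purity ρ) :=
        Finset.sum_le_sum fun a _ => termDefect_le (weight_le_one V ρ a)
    _ = _ := by
      rw [Finset.sum_add_distrib, Finset.sum_sub_distrib, ← Finset.mul_sum, ← Finset.sum_mul, hs,
        sum_weight, purityGain]
      ring

theorem purityGain_nonneg {d : ℕ} {A : Type*} [Fintype A] (V : KrausMeasurement d A)
    (ρ : State d) : 0 ≤ purityGain V ρ :=
  (Finset.sum_nonneg fun a _ => termDefect_nonneg (V.op a) ρ).trans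
    (sum_termDefect_le_purityGain V ρ)

/-- Hermitian matrices with the same characteristic polynomial are unitarily equivalent. -/
theorem unitarilyEquivalent_of_charpoly_eq {d : ℕ} {M N : Matrix (Fin d) (Fin d) ℂ}
    (hM : M.IsHermitian) (hN : N.IsHermitian) (h : M.charpoly = N.charpoly) :
    UnitarilyEquivalent M N := by
  have he := (hM.eigenvalues_eq_eigenvalues_iff hN).2 h
  obtain ⟨U, hUm, -, hMU⟩ := exists_diagonalization hM
  obtain ⟨W, hWm, hW, hNW⟩ := exists_diagonalization hN
  rw [he] at hMU
  refine ⟨U * Wᴴ, mul_mem hUm (Unitary.star_mem hWm), ?_⟩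
  generalize Matrix.diagonal (fun i => (hN.eigenvalues i : ℂ)) = D at hMU hNW
  rw [hMU, hNW, Matrix.conjTranspose_mul, Matrix.conjTranspose_conjTranspose]
  calc _ = U * 1 * D * 1 * Uᴴ := by simp only [Matrix.mul_one]
    _ = _ := by rw [← hW]; simp only [Matrix.mul_assoc]

/-! ### Eigenvalues and moments of a state -/

theorem weight_eq_trace {d : ℕ} {W : Matrix (Fin d) (Fin d) ℂ} {ρ : State d} :
    weight W ρ = (W * ρ.mat * Wᴴ).trace.re := rfl

theorem State.sum_eigenvalues {d : ℕ} (ρ : State d) :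
    ∑ i, ρ.posSemidef.isHermitian.eigenvalues i = 1 := by
  have := ρ.posSemidef.isHermitian.trace_eq_sum_eigenvalues
  rw [ρ.trace_eq_one, ← RCLike.ofReal_sum] at this
  exact (Complex.ofReal_injective (this.symm.trans Complex.ofReal_one.symm))

theorem State.trace_pow {d : ℕ} (ρ : State d) (m : ℕ) :
    (ρ.mat ^ m).trace.re = ∑ i, ρ.posSemidef.isHermitian.eigenvalues i ^ m := by
  conv_lhs => rw [ρ.posSemidef.isHermitian.spectral_theorem, ← map_pow,
    Unitary.conjStarAlgAut_apply, Matrix.trace_mul_comm, ← mul_assoc, Unitary.coe_star_mul_self,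
    one_mul, Matrix.diagonal_pow, Matrix.trace_diagonal, Complex.re_sum]
  refine Finset.sum_congr rfl fun i _ => ?_
  simp [← Complex.ofReal_pow]

theorem State.eigenvalues_nonneg {d : ℕ} (ρ : State d) (i : Fin d) :
    0 ≤ ρ.posSemidef.isHermitian.eigenvalues i := ρ.posSemidef.eigenvalues_nonneg i

theorem State.eigenvalues_le_one {d : ℕ} (ρ : State d) (i : Fin d) :
    ρ.posSemidef.isHermitian.eigenvalues i ≤ 1 := by
  rw [← ρ.sum_eigenvalues]
  exact Finset.single_le_sum (fun i _ => ρ.eigenvalues_nonneg i) (Finset.mem_univ i)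

theorem State.trace_pow_le_one {d : ℕ} (ρ : State d) {m : ℕ} (hm : 1 ≤ m) :
    (ρ.mat ^ m).trace.re ≤ 1 := by
  rw [ρ.trace_pow, ← ρ.sum_eigenvalues]
  exact Finset.sum_le_sum fun i _ =>
    pow_le_of_le_one (ρ.eigenvalues_nonneg i) (ρ.eigenvalues_le_one i) (by omega)

theorem purity_le_one {d : ℕ} (ρ : State d) : purity ρ ≤ 1 := ρ.trace_pow_le_one one_le_two

theorem purity_nonneg {d : ℕ} (ρ : State d) : 0 ≤ purity ρ := by
  rw [purity, ρ.trace_pow]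
  exact Finset.sum_nonneg fun i _ => sq_nonneg _

/-- Jensen's inequality with the eigenvalues serving both as weights and as points. It makes purity
tending to 1 force all higher moments to 1. -/
theorem State.purity_pow_le_trace_pow {d : ℕ} (ρ : State d) (m : ℕ) :
    purity ρ ^ m ≤ (ρ.mat ^ (m + 1)).trace.re := by
  rw [purity, ρ.trace_pow, ρ.trace_pow]
  have h := Real.pow_arith_mean_le_arith_mean_pow Finset.univ
    (ρ.posSemidef.isHermitian.eigenvalues) (ρ.posSemidef.isHermitian.eigenvalues)
    (fun i _ => ρ.eigenvalues_nonneg i) ρ.sum_eigenvalues (fun i _ => ρ.eigenvalues_nonneg i) m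
  simpa only [← pow_succ', ← pow_two] using h

theorem State.purity_eq_one_of_isPure {d : ℕ} {ρ : State d} (h : ρ.IsPure) : purity ρ = 1 := by
  rw [purity, pow_two, h.1.isIdempotentElem.eq, ρ.trace_eq_one, Complex.one_re]

theorem State.two_le_rank {d : ℕ} {ρ : State d} (h : purity ρ < 1) : 2 ≤ ρ.mat.rank := by
  rw [ρ.posSemidef.isHermitian.rank_eq_card_non_zero_eigs]
  by_contra! hc
  have hs : Subsingleton {i // ρ.posSemidef.isHermitian.eigenvalues i ≠ 0} :=
    Fintype.card_le_one_iff_subsingleton.1 (by omega)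
  obtain ⟨i, hi⟩ : ∃ i, ρ.posSemidef.isHermitian.eigenvalues i ≠ 0 := by
    by_contra! h0
    simpa [h0] using ρ.sum_eigenvalues
  have hz : ∀ j, j ≠ i → ρ.posSemidef.isHermitian.eigenvalues j = 0 := by
    intro j hj
    by_contra h0
    exact hj (congrArg Subtype.val (hs.elim ⟨j, h0⟩ ⟨i, hi⟩))
  have h1 : ρ.posSemidef.isHermitian.eigenvalues i = 1 := by
    rw [← ρ.sum_eigenvalues]
    exact (Finset.sum_eq_single i (fun j _ hj => hz j hj) (by simp)).symm
  rw [purity, ρ.trace_pow, Finset.sum_eq_single i (fun j _ hj => by simp [hz j hj]) (by simp),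
    h1] at h
  norm_num at h

/-! ### Dark states -/

/-- A non-pure state with vanishing defect is dark: the measurement reveals nothing about it. -/
theorem exists_dark_of_sum_termDefect_eq_zero {d : ℕ} {A : Type*} [Fintype A]
    (V : KrausMeasurement d A) (ψ : State d) (hψ : purity ψ < 1)
    (h0 : ∑ a, termDefect (V.op a) ψ.mat = 0) :
    ψ.IsMixed ∧
      (∀ m : ℕ, 1 ≤ m → m ≤ d → delta V m ψ = 0) ∧
      (∀ a : A, ∃ c : ℝ, 0 ≤ c ∧
        UnitarilyEquivalent (V.op a * ψ.mat * (V.op a)ᴴ) (c • ψ.mat)) ∧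
      ∃ p : Matrix (Fin d) (Fin d) ℂ, IsStarProjection p ∧
        LinearMap.range p.mulVecLin = LinearMap.range ψ.mat.mulVecLin ∧
        2 ≤ p.rank ∧
        ∀ a : A, ∃ c : ℝ, 0 ≤ c ∧ c ≤ 1 ∧
          p * (V.op a)ᴴ * V.op a * p = c • p := by
  obtain ⟨B, T, hB, hT, hBB, hTB, hBTB, hTBT⟩ := exists_sqrt_pseudoInverse ψ.posSemidef
  -- Each defect is nonnegative, so all vanish, and each is a squared Hilbert–Schmidt norm.
  have hS : ∀ a, B * (V.op a)ᴴ * V.op a * B = weight (V.op a) ψ • ψ.mat := by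
    intro a
    have ha := (Finset.sum_eq_zero_iff_of_nonneg
      fun a _ => termDefect_nonneg (V.op a) ψ).1 h0 a (Finset.mem_univ a)
    rw [termDefect_eq (V.op a) hBB weight_eq_trace.symm] at ha
    refine sub_eq_zero.1 (eq_zero_of_trace_self_mul ?_ ha)
    simp [hB, ψ.posSemidef.isHermitian.eq, Matrix.mul_assoc]
  have hU : ∀ a, UnitarilyEquivalent (V.op a * ψ.mat * (V.op a)ᴴ)
      (weight (V.op a) ψ • ψ.mat) := by
    intro a
    refine unitarilyEquivalent_of_charpoly_eq
      (ψ.posSemidef.mul_mul_conjTranspose_same (V.op a)).isHermitian ?_ ?_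
    · exact (ψ.posSemidef.smul (weight_nonneg (V.op a) ψ)).isHermitian
    -- X Y and Y X have the same characteristic polynomial; here X = V_a B and Y = B V_a†.
    · rw [← hS a, ← hBB, show V.op a * (B * B) * (V.op a)ᴴ = (V.op a * B) * (B * (V.op a)ᴴ) by
        simp only [Matrix.mul_assoc], Matrix.charpoly_mul_comm]
      simp only [Matrix.mul_assoc]
  refine ⟨fun hp => hψ.ne (State.purity_eq_one_of_isPure hp), fun m _ _ => ?_,
    fun a => ⟨_, weight_nonneg (V.op a) ψ, hU a⟩, B * T, ?_, ?_, ?_, fun a =>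
      ⟨_, weight_nonneg (V.op a) ψ, weight_le_one V ψ a, ?_⟩⟩
  · refine Finset.sum_eq_zero fun a _ => ?_
    rcases eq_or_ne (weight (V.op a) ψ) 0 with h | h
    · rw [h, zero_mul]
    · obtain ⟨U, hUm, hUeq⟩ := hU a
      have hUU : star U * U = 1 := Unitary.star_mul_self_of_mem hUm
      rw [act_mat h, hUeq, Matrix.mul_smul, Matrix.smul_mul, smul_smul, inv_mul_cancel₀ h,
        one_smul]
      have : (U * ψ.mat * Uᴴ) ^ m = U * ψ.mat ^ m * Uᴴ := by
        have := map_pow (Unitary.conjStarAlgAut ℂ (Matrix (Fin d) (Fin d) ℂ) ⟨U, hUm⟩) ψ.mat m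
        simp only [Unitary.conjStarAlgAut_apply] at this
        exact this.symm
      rw [this, Matrix.trace_mul_comm, ← Matrix.mul_assoc, ← Matrix.star_eq_conjTranspose, hUU,
        Matrix.one_mul]
      simp
  · refine ⟨?_, ?_⟩
    · rw [IsIdempotentElem, ← Matrix.mul_assoc, hBTB]
    · rw [IsSelfAdjoint, Matrix.star_eq_conjTranspose, Matrix.conjTranspose_mul, hB, hT, hTB]
  -- Each of B T and ψ is a left factor of the other, so their ranges agree.
  all_goals
    have hp : B * T = ψ.mat * (T * T) := by
      rw [← hBB, show B * B * (T * T) = B * (B * T) * T by simp only [Matrix.mul_assoc],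
        show B * (B * T) * T = B * (T * B * T) by rw [← hTB]; simp only [Matrix.mul_assoc], hTBT]
    have hψp : ψ.mat = B * T * ψ.mat := by
      rw [← hBB, ← Matrix.mul_assoc, hBTB]
    have hrange : LinearMap.range (B * T).mulVecLin = LinearMap.range ψ.mat.mulVecLin := by
      apply le_antisymm
      · conv_lhs => rw [hp, Matrix.mulVecLin_mul]
        exact LinearMap.range_comp_le_range _ _
      · conv_lhs => rw [hψp, Matrix.mulVecLin_mul]
        exact LinearMap.range_comp_le_range _ _
  · exact hrange
  · rw [Matrix.rank, hrange]
    exact State.two_le_rank hψ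
  -- Sandwich the identity `hS` between two copies of T and use T ψ T = B T.
  · calc B * T * (V.op a)ᴴ * V.op a * (B * T)
        = T * (B * (V.op a)ᴴ * V.op a * B) * T := by
          nth_rewrite 1 [← hTB]; simp only [Matrix.mul_assoc]
      _ = weight (V.op a) ψ • (B * T) := by
          rw [hS a, Matrix.mul_smul, Matrix.smul_mul, ← hBB, ← Matrix.mul_assoc, hTB, hBTB]

/-! ### Composition of updates and the law of the outcomes -/

theorem State.ext {d : ℕ} {ρ σ : State d} (h : ρ.mat = σ.mat) : ρ = σ := by
  cases ρ; cases σ; cases h; rfl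

theorem weight_mul {d : ℕ} (W R : Matrix (Fin d) (Fin d) ℂ) {ρ : State d}
    (hR : weight R ρ ≠ 0) : weight (W * R) ρ = weight W (act R ρ) * weight R ρ := by
  have h : W * R * ρ.mat * (W * R)ᴴ = W * (R * ρ.mat * Rᴴ) * Wᴴ := by
    rw [Matrix.conjTranspose_mul]; simp only [Matrix.mul_assoc]
  rw [weight, weight, act_mat hR, h, Matrix.mul_smul, Matrix.smul_mul, Matrix.trace_smul,
    Complex.real_smul, Complex.re_ofReal_mul]
  field_simp

/-- Positive weights matter: if only the second outcome has weight zero, the left side defaults to ρ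
and the right side to `act R ρ`. -/
theorem act_mul {d : ℕ} {W R : Matrix (Fin d) (Fin d) ℂ} {ρ : State d} (hR : weight R ρ ≠ 0)
    (hW : weight W (act R ρ) ≠ 0) : act (W * R) ρ = act W (act R ρ) := by
  have h : W * R * ρ.mat * (W * R)ᴴ = W * (R * ρ.mat * Rᴴ) * Wᴴ := by
    rw [Matrix.conjTranspose_mul]; simp only [Matrix.mul_assoc]
  have hw := weight_mul W R hR
  apply State.ext
  rw [act_mat (by rw [hw]; exact mul_ne_zero hW hR), act_mat hW, act_mat hR, hw, h,
    Matrix.mul_smul, Matrix.smul_mul, smul_smul, mul_inv]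

section Trajectory

variable {d : ℕ} {A : Type*} [Fintype A]

theorem prodOp_congr (W : ℕ → KrausMeasurement d A) {a b : ℕ → A} {n : ℕ}
    (h : ∀ i < n, a i = b i) : prodOp W a n = prodOp W b n := by
  induction n with
  | zero => rfl
  | succ n ih => rw [prodOp, prodOp, ih fun i hi => h i (by omega), h n (by omega)]

/-- A record indexed by `Finset.Iic n` holds n + 1 outcomes, which determine the first n + 1
factors. -/
theorem prodOp_extendRecord (W : ℕ → KrausMeasurement d A) (a : ℕ → A) (n : ℕ) :
    prodOp W (extendRecord (Preorder.frestrictLe (π := fun _ => A) n a)) (n + 1) =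
      prodOp W a (n + 1) := by
  refine prodOp_congr W fun i hi => ?_
  simp [extendRecord, min_eq_left (Nat.lt_succ_iff.1 hi)]

theorem trajState_extendRecord (W : ℕ → KrausMeasurement d A) (ρ : State d) (a : ℕ → A) (n : ℕ) :
    trajState W ρ (extendRecord (Preorder.frestrictLe (π := fun _ => A) n a)) (n + 1) =
      trajState W ρ a (n + 1) := by
  rw [trajState, prodOp_extendRecord, trajState]

variable [MeasurableSpace A] [MeasurableSingletonClass A]

instance (W : ℕ → KrausMeasurement d A) (ρ : State d) : IsProbabilityMeasure (quantumLaw W ρ) := by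
  have := PMF.toMeasure.isProbabilityMeasure (outcomeLaw (W 0) ρ)
  unfold quantumLaw
  infer_instance

theorem map_quantumLaw_compProd (W : ℕ → KrausMeasurement d A) (ρ : State d) (n : ℕ) :
    (quantumLaw W ρ).map (Preorder.frestrictLe (π := fun _ => A) n) ⊗ₘ nextOutcome W ρ n =
      (quantumLaw W ρ).map (fun x => (Preorder.frestrictLe (π := fun _ => A) n x, x (n + 1))) := by
  have := PMF.toMeasure.isProbabilityMeasure (outcomeLaw (W 0) ρ)
  exact Kernel.map_frestrictLe_trajMeasure_compProd_eq_map_trajMeasure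

theorem map_eval_zero_trajMeasure {X : ℕ → Type*} [∀ n, MeasurableSpace (X n)]
    (μ₀ : Measure (X 0)) (κ : (n : ℕ) → Kernel ((i : Finset.Iic n) → X i) (X (n + 1)))
    [∀ n, IsMarkovKernel (κ n)] :
    (Kernel.trajMeasure μ₀ κ).map (fun x => x 0) = μ₀ := by
  have h0 : (Kernel.trajMeasure μ₀ κ).map (Preorder.frestrictLe (π := X) 0) =
      μ₀.map (MeasurableEquiv.piUnique (fun i : Finset.Iic 0 => X i)).symm := by
    rw [Kernel.trajMeasure, Measure.map_comp _ _ (Preorder.measurable_frestrictLe 0),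
      Kernel.traj_map_frestrictLe, Kernel.partialTraj_self, Measure.id_comp]
    rfl
  have hm : Measurable fun y : (i : Finset.Iic 0) → X i => y ⟨0, Finset.mem_Iic.2 le_rfl⟩ :=
    measurable_pi_apply _
  have h1 := Measure.map_map (μ := Kernel.trajMeasure μ₀ κ) hm
    (Preorder.measurable_frestrictLe (X := X) 0)
  refine h1.symm.trans ?_
  rw [h0]
  refine (Measure.map_map (μ := μ₀) hm (MeasurableEquiv.measurable _)).trans ?_
  exact Measure.map_id

theorem map_quantumLaw_zero (W : ℕ → KrausMeasurement d A) (ρ : State d) :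
    (quantumLaw W ρ).map (fun x => x 0) = (outcomeLaw (W 0) ρ).toMeasure :=
  map_eval_zero_trajMeasure (X := fun _ => A) _ _

theorem ae_outcomeLaw_weight_ne_zero (V : KrausMeasurement d A) (ρ : State d) :
    ∀ᵐ a ∂(outcomeLaw V ρ).toMeasure, weight (V.op a) ρ ≠ 0 := by
  rw [ae_iff, PMF.toMeasure_apply_eq_zero_iff _ (Set.toFinite _).measurableSet,
    Set.disjoint_left]
  intro a ha ha'
  simp only [ne_eq, not_not, Set.mem_ofPred_eq] at ha'
  rw [PMF.mem_support_iff, outcomeLaw, PMF.ofFintype_apply, ha', ENNReal.ofReal_zero] at ha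
  exact ha rfl

/-- Almost surely, the next outcome has positive probability in the current state. -/
theorem ae_weight_trajState_ne_zero (W : ℕ → KrausMeasurement d A) (ρ : State d) (n : ℕ) :
    ∀ᵐ a ∂quantumLaw W ρ,
      weight ((W (n + 1)).op (a (n + 1))) (trajState W ρ a (n + 1)) ≠ 0 := by
  have h : ∀ᵐ x ∂(quantumLaw W ρ).map
      (fun x => (Preorder.frestrictLe (π := fun _ => A) n x, x (n + 1))),
      weight ((W (n + 1)).op x.2) (trajState W ρ (extendRecord x.1) (n + 1)) ≠ 0 := by
    rw [← map_quantumLaw_compProd, Measure.ae_compProd_iff (Set.toFinite _).measurableSet]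
    exact Eventually.of_forall fun x => ae_outcomeLaw_weight_ne_zero (W (n + 1))
      (trajState W ρ (extendRecord x) (n + 1))
  have hm : Measurable fun x : ℕ → A =>
    (Preorder.frestrictLe (π := fun _ => A) n x, x (n + 1)) := by fun_prop
  have h' := ae_of_ae_map hm.aemeasurable h
  simpa only [trajState_extendRecord] using h'

/-- Almost surely, every finite record has positive probability. -/
theorem ae_weight_prodOp_ne_zero (W : ℕ → KrausMeasurement d A) (ρ : State d) (n : ℕ) :
    ∀ᵐ a ∂quantumLaw W ρ, weight (prodOp W a (n + 1)) ρ ≠ 0 := by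
  induction n with
  | zero =>
    have h := ae_outcomeLaw_weight_ne_zero (W 0) ρ
    rw [← map_quantumLaw_zero W ρ] at h
    filter_upwards [ae_of_ae_map (measurable_pi_apply 0).aemeasurable h] with a ha
    simpa [prodOp] using ha
  | succ n ih =>
    filter_upwards [ih, ae_weight_trajState_ne_zero W ρ n] with a h1 h2
    rw [prodOp, weight_mul _ _ h1]
    exact mul_ne_zero h2 h1

/-- Trajectory states are defined from the whole product, so the one-step recursion holds only off
the null set of records with an impossible outcome. -/
theorem ae_trajState_succ (W : ℕ → KrausMeasurement d A) (ρ : State d) (n : ℕ) :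
    ∀ᵐ a ∂quantumLaw W ρ, trajState W ρ a (n + 2) =
      act ((W (n + 1)).op (a (n + 1))) (trajState W ρ a (n + 1)) := by
  filter_upwards [ae_weight_prodOp_ne_zero W ρ n, ae_weight_trajState_ne_zero W ρ n] with a h1 h2
  exact act_mul h1 h2

theorem integrable_comp_frestrictLe (W : ℕ → KrausMeasurement d A) (ρ : State d) (n : ℕ)
    (g : (Finset.Iic n → A) → ℝ) :
    Integrable (fun a => g (Preorder.frestrictLe (π := fun _ => A) n a)) (quantumLaw W ρ) := by
  have h : Integrable g
      ((quantumLaw W ρ).map (Preorder.frestrictLe (π := fun _ => A) n)) := .of_finite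
  exact h.comp_measurable (by fun_prop)

/-- The state depends on finitely many outcomes from a finite set, so g may be arbitrary. -/
theorem integrable_trajState (W : ℕ → KrausMeasurement d A) (ρ : State d) (n : ℕ)
    (g : State d → ℝ) :
    Integrable (fun a => g (trajState W ρ a (n + 1))) (quantumLaw W ρ) := by
  simpa only [trajState_extendRecord] using
    integrable_comp_frestrictLe W ρ n fun x => g (trajState W ρ (extendRecord x) (n + 1))

/-! ### Purity as a submartingale -/

/-- The expected purity grows by the expected purity gain, on any event of the past. -/
theorem setIntegral_purity_succ (W : ℕ → KrausMeasurement d A) (ρ : State d) (n : ℕ)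
    (s : Set (Finset.Iic n → A)) :
    ∫ a in Preorder.frestrictLe (π := fun _ => A) n ⁻¹' s,
        purity (trajState W ρ a (n + 2)) ∂quantumLaw W ρ =
      ∫ a in Preorder.frestrictLe (π := fun _ => A) n ⁻¹' s,
        (purity (trajState W ρ a (n + 1)) + purityGain (W (n + 1)) (trajState W ρ a (n + 1)))
        ∂quantumLaw W ρ := by
  have hs : MeasurableSet s := (Set.toFinite s).measurableSet
  have hs' : MeasurableSet (Preorder.frestrictLe (π := fun _ => A) n ⁻¹' s) :=
    (Preorder.measurable_frestrictLe n) hs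
  let g : (Finset.Iic n → A) × A → ℝ := fun x => s.indicator (fun _ =>
    purity (act ((W (n + 1)).op x.2) (trajState W ρ (extendRecord x.1) (n + 1)))) x.1
  calc _ = ∫ a, g (Preorder.frestrictLe (π := fun _ => A) n a, a (n + 1)) ∂quantumLaw W ρ := by
        rw [← integral_indicator hs']
        refine integral_congr_ae ?_
        filter_upwards [ae_trajState_succ W ρ n] with a ha
        classical
        simp only [g, trajState_extendRecord, Set.indicator_apply, Set.mem_preimage, ha]
    _ = ∫ x, g x ∂((quantumLaw W ρ).map (Preorder.frestrictLe (π := fun _ => A) n) ⊗ₘ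
          nextOutcome W ρ n) := by
        rw [map_quantumLaw_compProd, integral_map (by fun_prop)
          (measurable_of_finite g).aestronglyMeasurable]
    _ = ∫ x, s.indicator (fun x => purity (trajState W ρ (extendRecord x) (n + 1)) +
          purityGain (W (n + 1)) (trajState W ρ (extendRecord x) (n + 1))) x
          ∂(quantumLaw W ρ).map (Preorder.frestrictLe (π := fun _ => A) n) := by
        rw [Measure.integral_compProd .of_finite]
        refine integral_congr_ae (Eventually.of_forall fun x => ?_)
        have hκ : nextOutcome W ρ n x = (outcomeLaw (W (n + 1))
          (trajState W ρ (extendRecord x) (n + 1))).toMeasure := rfl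
        classical
        simp only [g, hκ, PMF.integral_eq_sum, outcomeLaw, PMF.ofFintype_apply,
          ENNReal.toReal_ofReal (weight_nonneg _ _), smul_eq_mul,
          Set.indicator_apply]
        split_ifs
        · rw [purityGain]; ring
        · simp
    _ = _ := by
        rw [integral_map (by fun_prop) (measurable_of_finite _).aestronglyMeasurable,
          ← integral_indicator hs']
        classical
        simp only [Set.indicator_apply, Set.mem_preimage, trajState_extendRecord]

theorem submartingale_purity (W : ℕ → KrausMeasurement d A) (ρ : State d) :
    Submartingale (fun n a => purity (trajState W ρ a (n + 1)))
      (Filtration.piLE (X := fun _ : ℕ => A)) (quantumLaw W ρ) := by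
  refine submartingale_of_setIntegral_le_succ ?_ (fun n => integrable_trajState W ρ n purity) ?_
  · intro n
    rw [Filtration.piLE_eq_comap_frestrictLe]
    have h : Measurable fun x : Finset.Iic n → A =>
        purity (trajState W ρ (extendRecord x) (n + 1)) := measurable_of_finite _
    have h' := h.comp (comap_measurable (Preorder.frestrictLe (π := fun _ => A) n))
    simp only [Function.comp_def, trajState_extendRecord] at h'
    exact h'.stronglyMeasurable
  · intro n s hs
    rw [Filtration.piLE_eq_comap_frestrictLe] at hs
    obtain ⟨t, -, rfl⟩ := hs
    rw [setIntegral_purity_succ]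
    refine setIntegral_mono (integrable_trajState W ρ n purity).integrableOn
      (integrable_trajState W ρ n fun σ => purity σ + purityGain (W (n + 1)) σ).integrableOn
      fun a => le_add_of_nonneg_right (purityGain_nonneg _ _)

/-- Bounded submartingales converge almost surely. By dominated convergence the limit has integral
1, and being at most 1 it equals 1 almost surely. -/
theorem ae_tendsto_purity_one {W : ℕ → KrausMeasurement d A} {ρ : State d}
    (h : Tendsto (fun n => ∫ a, purity (trajState W ρ a (n + 1)) ∂quantumLaw W ρ) atTop (𝓝 1)) :
    ∀ᵐ a ∂quantumLaw W ρ, Tendsto (fun n => purity (trajState W ρ a n)) atTop (𝓝 1) := by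
  have hbd : ∀ n a, ‖purity (trajState W ρ a (n + 1))‖ ≤ 1 := fun n a => by
    rw [Real.norm_of_nonneg (purity_nonneg _)]; exact purity_le_one _
  have hconv := (submartingale_purity W ρ).exists_ae_tendsto_of_bdd (R := 1) fun n => by
    refine (eLpNorm_le_of_ae_bound (C := 1) (Eventually.of_forall (hbd n))).trans ?_
    simp
  set g : (ℕ → A) → ℝ := fun a => limUnder atTop fun n => purity (trajState W ρ a (n + 1))
  have hlim : ∀ᵐ a ∂quantumLaw W ρ,
      Tendsto (fun n => purity (trajState W ρ a (n + 1))) atTop (𝓝 (g a)) :=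
    hconv.mono fun a ha => tendsto_nhds_limUnder ha
  have hg := tendsto_integral_of_dominated_convergence (fun _ => (1 : ℝ))
    (fun n => (integrable_trajState W ρ n purity).aestronglyMeasurable) (integrable_const 1)
    (fun n => Eventually.of_forall (hbd n)) hlim
  have hg1 : ∫ a, g a ∂quantumLaw W ρ = 1 := tendsto_nhds_unique hg h
  have hgi : Integrable g (quantumLaw W ρ) := by
    -- A non-integrable function would have integral 0 by convention, not 1.
    by_contra hi
    rw [integral_undef hi] at hg1
    exact zero_ne_one hg1
  have hgle : ∀ᵐ a ∂quantumLaw W ρ, g a ≤ 1 := by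
    filter_upwards [hlim] with a ha
    exact le_of_tendsto' ha fun n => purity_le_one _
  have hz := (integral_eq_zero_iff_of_nonneg_ae (f := fun a => 1 - g a)
    (by filter_upwards [hgle] with a ha using sub_nonneg.2 ha) ((integrable_const 1).sub hgi)).1
    (by rw [integral_sub (integrable_const 1) hgi, hg1]; simp)
  filter_upwards [hlim, hz] with a ha ha'
  have : g a = 1 := (sub_eq_zero.1 ha').symm
  rw [this] at ha
  exact (tendsto_add_atTop_iff_nat 1).1 ha

/-- If purification fails, then the measurements at all late times have nearly dark states which
stay away from the pure states. -/
theorem exists_nearly_dark_of_not_purify {W : ℕ → KrausMeasurement d A} {ρ : State d} {m : ℕ}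
    (hm : 1 ≤ m)
    (h : ¬ ∀ᵐ a ∂quantumLaw W ρ,
      Tendsto (fun n => ((trajState W ρ a n).mat ^ m).trace.re) atTop (𝓝 1)) :
    ∃ c : ℝ, 0 < c ∧ ∀ ε : ℝ, 0 < ε → ∀ᶠ n in atTop, ∃ σ : State d, purity σ ≤ 1 - c ∧
      purityGain (W n) σ ≤ ε := by
  set E : ℕ → ℝ := fun n => ∫ a, purity (trajState W ρ a (n + 1)) ∂quantumLaw W ρ with hE
  set G : ℕ → ℝ := fun n =>
    ∫ a, purityGain (W (n + 1)) (trajState W ρ a (n + 1)) ∂quantumLaw W ρ with hG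
  have hEG : ∀ n, E (n + 1) = E n + G n := by
    intro n
    have := setIntegral_purity_succ W ρ n Set.univ
    rw [Set.preimage_univ, setIntegral_univ, setIntegral_univ,
      integral_add (integrable_trajState W ρ n purity) (integrable_trajState W ρ n _)] at this
    exact this
  have hG0 : ∀ n, 0 ≤ G n := fun n => integral_nonneg fun a => purityGain_nonneg _ _
  have hE1 : ∀ n, E n ≤ 1 := by
    intro n
    have := integral_mono (integrable_trajState W ρ n purity) (integrable_const (1 : ℝ))
      fun a => purity_le_one _
    simpa using this
  have hmono : Monotone E := monotone_nat_of_le_succ fun n => by rw [hEG]; linarith [hG0 n]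
  have hbdd : BddAbove (Set.range E) := ⟨1, by rintro _ ⟨n, rfl⟩; exact hE1 n⟩
  have hlim := tendsto_atTop_ciSup hmono hbdd
  have hle : ∀ n, E n ≤ ⨆ n, E n := le_ciSup hbdd
  generalize (⨆ n, E n) = L at hlim hle
  -- If L were 1, purity would tend to 1 almost surely, and Jensen would squeeze the m-th moment to
  -- 1.
  have hL : L < 1 := by
    refine lt_of_le_of_ne (le_of_tendsto' hlim hE1) ?_
    rintro rfl
    refine h ?_
    filter_upwards [ae_tendsto_purity_one hlim] with a ha
    obtain ⟨k, rfl⟩ : ∃ k, m = k + 1 := ⟨m - 1, by omega⟩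
    refine tendsto_of_tendsto_of_tendsto_of_le_of_le (by simpa using ha.pow k) tendsto_const_nhds
      (fun n => State.purity_pow_le_trace_pow _ k) (fun n => State.trace_pow_le_one _ hm)
  have hGlim : Tendsto G atTop (𝓝 0) := by
    have := ((tendsto_add_atTop_iff_nat 1).2 hlim).sub hlim
    rw [sub_self] at this
    refine this.congr fun n => ?_
    rw [hEG]; ring
  refine ⟨(1 - L) / 2, by linarith, fun ε hε => ?_⟩
  have hev := hGlim.eventually (gt_mem_nhds (show 0 < ε * ((1 - L) / 2) by
    have : 0 < 1 - L := by linarith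
    positivity))
  obtain ⟨N, hN⟩ := eventually_atTop.1 hev
  refine eventually_atTop.2 ⟨N + 1, fun n hn => ?_⟩
  obtain ⟨k, rfl⟩ : ∃ k, n = k + 1 := ⟨n - 1, by omega⟩
  have hk := hN k (by omega)
  have hi := integrable_trajState W ρ k purity
  have hi' := integrable_trajState W ρ k (purityGain (W (k + 1)))
  -- Some record makes 1 − purity − gain/ε at least its mean, which is at least (1 − L)/2. As gain
  -- and purity are nonnegative, this single inequality yields both required bounds.
  obtain ⟨a, ha⟩ := exists_integral_le (μ := quantumLaw W ρ)
    (((integrable_const (1 : ℝ)).sub hi).sub (hi'.const_mul ε⁻¹))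
  simp only [Pi.sub_apply] at ha
  have hint : (1 - L) / 2 ≤ ∫ a, (1 - purity (trajState W ρ a (k + 1)) -
      ε⁻¹ * purityGain (W (k + 1)) (trajState W ρ a (k + 1))) ∂quantumLaw W ρ := by
    have h0 := integral_sub ((integrable_const (1 : ℝ)).sub hi) (hi'.const_mul ε⁻¹)
    simp only [Pi.sub_apply] at h0
    rw [h0, integral_sub (integrable_const (1 : ℝ)) hi, integral_const_mul]
    have h1 : ε⁻¹ * G k ≤ (1 - L) / 2 := by
      rw [inv_mul_le_iff₀ hε]; exact hk.le
    have h2 := hle k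
    simp only [hE, hG] at h1 h2
    simp only [integral_const, probReal_univ, one_smul]
    linarith
  have hg := mul_nonneg (inv_pos.2 hε).le
    (purityGain_nonneg (W (k + 1)) (trajState W ρ a (k + 1)))
  refine ⟨trajState W ρ a (k + 1), by linarith, ?_⟩
  have h1 : ε⁻¹ * purityGain (W (k + 1)) (trajState W ρ a (k + 1)) ≤ 1 := by
    linarith [purity_nonneg (trajState W ρ a (k + 1))]
  rw [inv_mul_le_iff₀ hε, mul_one] at h1
  exact h1

end Trajectory

/-! ### Compactness of states and continuity of the defect -/

theorem purity_eq_sum_normSq {d : ℕ} (ρ : State d) :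
    purity ρ = ∑ i, ∑ j, Complex.normSq (ρ.mat i j) := by
  have h : ρ.mat ^ 2 = ρ.mat * ρ.matᴴ := by rw [ρ.posSemidef.isHermitian.eq, pow_two]
  rw [purity, h]
  simp only [Matrix.trace, Matrix.diag_apply, Matrix.mul_apply, Matrix.conjTranspose_apply,
    Complex.re_sum, RCLike.star_def, Complex.mul_conj, Complex.ofReal_re]

theorem norm_apply_le_one {d : ℕ} (ρ : State d) (i j : Fin d) : ‖ρ.mat i j‖ ≤ 1 := by
  have h1 : Complex.normSq (ρ.mat i j) ≤ 1 := by
    refine le_trans ?_ ((purity_eq_sum_normSq ρ).symm.le.trans (purity_le_one ρ))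
    refine le_trans ?_ (Finset.single_le_sum (f := fun i => ∑ j, Complex.normSq (ρ.mat i j))
      (fun i _ => Finset.sum_nonneg fun j _ => Complex.normSq_nonneg _) (Finset.mem_univ i))
    exact Finset.single_le_sum (f := fun j => Complex.normSq (ρ.mat i j))
      (fun j _ => Complex.normSq_nonneg _) (Finset.mem_univ j)
  rw [Complex.normSq_eq_norm_sq] at h1
  exact (sq_le_one_iff₀ (norm_nonneg _)).1 h1

theorem isCompact_states_purity_le {d : ℕ} (c : ℝ) :
    IsCompact {M : Matrix (Fin d) (Fin d) ℂ | ∃ σ : State d, σ.mat = M ∧ purity σ ≤ c} := by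
  have hK : IsCompact (Set.pi Set.univ fun _ : Fin d => Set.pi Set.univ fun _ : Fin d =>
      Metric.closedBall (0 : ℂ) 1) :=
    isCompact_univ_pi fun _ => isCompact_univ_pi fun _ => isCompact_closedBall 0 1
  refine hK.of_isClosed_subset ?_ ?_
  · have h : {M : Matrix (Fin d) (Fin d) ℂ | ∃ σ : State d, σ.mat = M ∧ purity σ ≤ c} =
        ({M | Mᴴ = M} ∩ ⋂ x : Fin d → ℂ, {M | 0 ≤ star x ⬝ᵥ M *ᵥ x}) ∩
          ({M | M.trace = 1} ∩ {M | (M ^ 2).trace.re ≤ c}) := by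
      ext M
      simp only [Set.mem_ofPred_eq, Set.mem_inter_iff, Set.mem_iInter]
      constructor
      · rintro ⟨σ, rfl, hσ⟩
        exact ⟨⟨σ.posSemidef.isHermitian, fun x => σ.posSemidef.dotProduct_mulVec_nonneg x⟩,
          σ.trace_eq_one, hσ⟩
      · rintro ⟨⟨h1, h2⟩, h3, h4⟩
        exact ⟨⟨M, Matrix.PosSemidef.of_dotProduct_mulVec_nonneg h1 h2, h3⟩, rfl, h4⟩
    rw [h]
    refine ((isClosed_eq (by fun_prop) (by fun_prop)).inter (isClosed_iInter fun x => ?_)).inter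
      ((isClosed_eq (by fun_prop) (by fun_prop)).inter (isClosed_le (by fun_prop) (by fun_prop)))
    exact isClosed_le (by fun_prop) (by fun_prop)
  · rintro M ⟨σ, rfl, -⟩ i - j -
    simpa using norm_apply_le_one σ i j

theorem continuous_termDefect {X : Type*} [TopologicalSpace X] {d : ℕ}
    {f g : X → Matrix (Fin d) (Fin d) ℂ} (hf : Continuous f) (hg : Continuous g) :
    Continuous fun x => termDefect (f x) (g x) := by
  unfold termDefect
  fun_prop

theorem continuous_sum_termDefect {d : ℕ} {A : Type*} [Fintype A] : Continuous fun x :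
    (A → Matrix (Fin d) (Fin d) ℂ) × Matrix (Fin d) (Fin d) ℂ =>
      ∑ a, termDefect (x.1 a) x.2 :=
  continuous_finsetSum Finset.univ fun a _ =>
    continuous_termDefect ((continuous_apply a).comp continuous_fst) continuous_snd

/-! ### Recurrence and the passage to the limit -/

/-- Poincaré recurrence for an observable with values in a second countable space: almost every
orbit returns infinitely often to every neighbourhood of the initial value. -/
theorem ae_frequently_mem_of_mem_nhds_apply {Ω E : Type*} [MeasurableSpace Ω] {P : Measure Ω}
    {θ : Ω → Ω} (hθ : Conservative θ P) [TopologicalSpace E] [SecondCountableTopology E]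
    [MeasurableSpace E] [OpensMeasurableSpace E] {g : Ω → E} (hg : Measurable g) :
    ∀ᵐ ω ∂P, ∀ s ∈ 𝓝 (g ω), ∃ᶠ n in atTop, g (θ^[n] ω) ∈ s := by
  have h : ∀ s ∈ TopologicalSpace.countableBasis E,
      ∀ᵐ ω ∂P, g ω ∈ s → ∃ᶠ n in atTop, g (θ^[n] ω) ∈ s := fun s hs =>
    hθ.ae_mem_imp_frequently_image_mem (hg
      (TopologicalSpace.isOpen_of_mem_countableBasis hs).measurableSet).nullMeasurableSet
  filter_upwards [(ae_ball_iff (TopologicalSpace.countable_countableBasis E)).2 h] with ω hω s hs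
  obtain ⟨o, ho, hωo, hos⟩ := (TopologicalSpace.isBasis_countableBasis E).mem_nhds_iff.1 hs
  exact (hω o ho hωo).mono fun n hn => hos hn

/-- A tube-lemma argument: a strict lower bound on a compact fibre persists on nearby fibres. -/
theorem eventually_forall_mem_lt {E F : Type*} [TopologicalSpace E] [TopologicalSpace F]
    {D : E → F → ℝ} (hD : Continuous fun x : E × F => D x.1 x.2) {K : Set F} (hK : IsCompact K)
    {v : E} {r : ℝ} (h : ∀ M ∈ K, r < D v M) : ∀ᶠ w in 𝓝 v, ∀ M ∈ K, r < D w M :=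
  hK.eventually_forall_of_forall_eventually fun M hM =>
    hD.continuousAt.eventually (lt_mem_nhds (h M hM))

/-- If the values `w n` of a sequence return to every neighbourhood of `v`, and `D (w n)` is almost
zero somewhere on the compact set `K` for all late `n`, then `D v` has a zero on `K`. -/
theorem exists_mem_eq_zero_of_frequently {E F : Type*} [TopologicalSpace E] [TopologicalSpace F]
    {D : E → F → ℝ} (hD : Continuous fun x : E × F => D x.1 x.2) {K : Set F} (hK : IsCompact K)
    {v : E} (h0 : ∀ M ∈ K, 0 ≤ D v M) {w : ℕ → E} (hw : ∀ s ∈ 𝓝 v, ∃ᶠ n in atTop, w n ∈ s)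
    (h : ∀ ε : ℝ, 0 < ε → ∀ᶠ n in atTop, ∃ M ∈ K, D (w n) M ≤ ε) : ∃ M ∈ K, D v M = 0 := by
  obtain ⟨_, M₀, hM₀, -⟩ := (h 1 one_pos).exists
  have hDv : Continuous (D v) := hD.comp (Continuous.prodMk_right v)
  obtain ⟨M, hM, hmin⟩ := hK.exists_isMinOn ⟨M₀, hM₀⟩ hDv.continuousOn
  refine ⟨M, hM, ?_⟩
  by_contra hne
  have hpos : 0 < D v M := lt_of_le_of_ne (h0 M hM) (Ne.symm hne)
  -- A positive minimum would keep D above half of it on K for all w near v, against the near-zeros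
  -- at return times.
  have hev := eventually_forall_mem_lt hD hK (v := v) (r := D v M / 2) fun N hN =>
    (half_lt_self hpos).trans_le (isMinOn_iff.1 hmin N hN)
  obtain ⟨n, hn, N, hN, hle⟩ := ((hw _ hev).and_eventually (h _ (half_pos hpos))).exists
  exact (hn N hN).not_ge hle

theorem exists_sum_termDefect_eq_zero {d : ℕ} {A : Type*} [Fintype A]
    {W : ℕ → KrausMeasurement d A} {V : KrausMeasurement d A}
    (hV : ∀ s ∈ 𝓝 V.op, ∃ᶠ n in atTop, (W n).op ∈ s) {c : ℝ}
    (hc : ∀ ε : ℝ, 0 < ε → ∀ᶠ n in atTop, ∃ σ : State d, purity σ ≤ c ∧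
      purityGain (W n) σ ≤ ε) :
    ∃ ψ : State d, purity ψ ≤ c ∧ ∑ a, termDefect (V.op a) ψ.mat = 0 := by
  obtain ⟨_, ⟨ψ, rfl, hψ⟩, h⟩ := exists_mem_eq_zero_of_frequently
    (D := fun (v : A → Matrix (Fin d) (Fin d) ℂ) M => ∑ a, termDefect (v a) M)
    (continuous_sum_termDefect (d := d) (A := A)) (isCompact_states_purity_le (d := d) c)
    (v := V.op) (w := fun n => (W n).op) (by
      rintro _ ⟨σ, rfl, -⟩
      exact Finset.sum_nonneg fun a _ => termDefect_nonneg (V.op a) σ) hV fun ε hε =>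
    (hc ε hε).mono fun n ⟨σ, hσ, hle⟩ =>
      ⟨σ.mat, ⟨σ, rfl, hσ⟩, (sum_termDefect_le_purityGain (W n) σ).trans hle⟩
  exact ⟨ψ, hψ, h⟩

end DisorderedTrajectory

end

theorem mainTheorem4 {Ω : Type*} [MeasurableSpace Ω] (P : Measure Ω) [IsProbabilityMeasure P]
    (θ : Ω ≃ᵐ Ω) (hθ : MeasurePreserving θ P P)
    {d : ℕ} {A : Type*} [Fintype A] [MeasurableSpace A] [MeasurableSingletonClass A]
    (V : Ω → DisorderedTrajectory.KrausMeasurement d A)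
    (hV : ∀ (a : A) (i j : Fin d), Measurable fun ω => (V ω).op a i j) :
    ∀ᵐ ω ∂P, ω ∉ DisorderedTrajectory.purificationEvent θ V →
      ∃ ψ : DisorderedTrajectory.State d, ψ.IsMixed ∧
        (∀ m : ℕ, 1 ≤ m → m ≤ d → DisorderedTrajectory.delta (V ω) m ψ = 0) ∧
        (∀ a : A, ∃ c : ℝ, 0 ≤ c ∧
          DisorderedTrajectory.UnitarilyEquivalent
            ((V ω).op a * ψ.mat * ((V ω).op a)ᴴ) (c • ψ.mat)) ∧
        ∃ p : Matrix (Fin d) (Fin d) ℂ, IsStarProjection p ∧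
          LinearMap.range p.mulVecLin = LinearMap.range ψ.mat.mulVecLin ∧
          2 ≤ p.rank ∧
          ∀ a : A, ∃ c : ℝ, 0 ≤ c ∧ c ≤ 1 ∧
            p * ((V ω).op a)ᴴ * (V ω).op a * p = c • p := by
  -- Recurrence is applied to the Kraus family as a point of a finite-dimensional function space.
  let g : Ω → A → Fin d → Fin d → ℂ := fun ω => (V ω).op
  have hg : Measurable g :=
    measurable_pi_lambda _ fun a => measurable_pi_lambda _ fun i => measurable_pi_lambda _ (hV a i)
  filter_upwards [DisorderedTrajectory.ae_frequently_mem_of_mem_nhds_apply hθ.conservative hg]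
    with ω hω hX
  simp only [DisorderedTrajectory.purificationEvent, Set.mem_ofPred_eq, not_forall] at hX
  obtain ⟨ρ, m, hm, h⟩ := hX
  obtain ⟨c, hc, hdark⟩ := DisorderedTrajectory.exists_nearly_dark_of_not_purify hm h
  obtain ⟨ψ, hψ, h0⟩ := DisorderedTrajectory.exists_sum_termDefect_eq_zero
    (W := fun n => V (θ^[n] ω)) (V := V ω) (c := 1 - c) hω fun ε hε => by
      -- Entry k of the orbit sequence is V at θ^(k+1) ω, whence the shift by one.
      obtain ⟨N, hN⟩ := eventually_atTop.1 (hdark ε hε)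
      refine eventually_atTop.2 ⟨N + 1, fun n hn => ?_⟩
      obtain ⟨k, rfl⟩ : ∃ k, n = k + 1 := ⟨n - 1, by omega⟩
      exact hN k (by omega)
  exact ⟨ψ, DisorderedTrajectory.exists_dark_of_sum_termDefect_eq_zero (V ω) ψ
    (by linarith) h0⟩
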